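/- For real $a,b,c$ with $c\notin\{0,-1,-2,\dots\}$ and $|x|<1$ let $$F(a,b;c;x)=\sum_{n=0}^{\infty}\frac{(a,n)(b,n)}{(c,n)}\frac{x^n}{n!},\qquad (a,0)=1,\quad (a,n)=a(a+1)\cdots(a+n-1)\ (n\ge 1),$$ be the Gaussian hypergeometric function, and for $x,y>0$ let $B(x,y)=\Gamma(x)\Gamma(y)/\Gamma(x+y)$ be the beta function. **Theorem.** Let $a\in(0,1)$, $b\ge 1-a$, and put $$\alpha=a(b+1),\quad \beta=b(1-a),\quad p=\alpha+\beta=a+b,\quad h=\alpha\beta(p+\beta),\quad k=\beta(p+1)+p.$$ Assume that either $\alpha\ge\sqrt3\,\beta$, or both $\alpha<\sqrt3\,\beta$ and $4h(\beta+p)\ge p^4$. Let $c,d>0$ with $c/d\le(\beta+p)/k$, and let $$\delta_1=\frac{(a-b-1)+\sqrt{(p-1)^2+4\beta c/d}}{2}.$$ Then $\delta_1$ is the larger root of $(c/d-1)\beta+(a-b-1)\delta-\delta^2=0$, $\delta_1<0$, and the following hold. (1) If $\delta\in(a-1,\delta_1]$, then the function $$G(x)=\frac{F(a-1-\delta,b+\delta;p;1-x^d)-F(a-1,b;p;1-x^c)}{1-x^c}$$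 is strictly decreasing on $(0,1)$ and maps $(0,1)$ onto $(C_1(\delta),C_2(\delta))$, where $$C_1(\delta)=\frac{d}{pc}\left(\Big(\frac cd-1\Big)\beta+(a-b-1)\delta-\delta^2\right)\ge 0,\qquad C_2(\delta)=\frac{1}{p\,B(a-\delta,b+1+\delta)}-\frac{1}{p\,B(a,b+1)}.$$ In particular, for all $x\in(0,1)$ and $\delta\in(a-1,\delta_1]$, $$F(a-1,b;p;1-x^c)+C_1(\delta)(1-x^c)<F(a-1-\delta,b+\delta;p;1-x^d)<F(a-1,b;p;1-x^c)+C_2(\delta)(1-x^c).$$ (2) If $\delta_1<\delta<0$, then $F(a-1-\delta,b+\delta;p;1-x^d)$ and $F(a-1,b;p;1-x^c)$, as functions of $x$, are not comparable on $(0,1)$; that is, neither $$F(a-1,b;p;1-x^c)<F(a-1-\delta,b+\delta;p;1-x^d)$$ nor the reversed inequality holds for all $x\in(0,1)$. -/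

import Mathlib

open Set

noncomputable section

namespace ZeroBalanced

/-- The real Gaussian hypergeometric function `F(a, b; c; x) = ∑ (a,n)(b,n)/(c,n) xⁿ/n!`. -/
def F (a b c x : ℝ) : ℝ := ordinaryHypergeometric a b c x

/-- Euler's beta function `B(x, y) = Γ(x)Γ(y)/Γ(x+y)`. -/
def B (x y : ℝ) : ℝ := ProbabilityTheory.beta x y

def α (a b : ℝ) : ℝ := a * (b + 1)

def β (a b : ℝ) : ℝ := b * (1 - a)

def p (a b : ℝ) : ℝ := a + b

def h (a b : ℝ) : ℝ := α a b * β a b * (p a b + β a b)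

def k (a b : ℝ) : ℝ := β a b * (p a b + 1) + p a b

/-- The quadratic `(c/d - 1)β + (a - b - 1)δ - δ²`. -/
def q (a b c d δ : ℝ) : ℝ := (c / d - 1) * β a b + (a - b - 1) * δ - δ ^ 2

/-- The explicit value of the larger root of `q`. -/
def δ₁ (a b c d : ℝ) : ℝ :=
  ((a - b - 1) + √((p a b - 1) ^ 2 + 4 * β a b * (c / d))) / 2

def G (a b c d δ x : ℝ) : ℝ :=
  (F (a - 1 - δ) (b + δ) (p a b) (1 - x ^ d) - F (a - 1) b (p a b) (1 - x ^ c)) / (1 - x ^ c)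

def C₁ (a b c d δ : ℝ) : ℝ := d / (p a b * c) * q a b c d δ

def C₂ (a b δ : ℝ) : ℝ :=
  1 / (p a b * B (a - δ) (b + 1 + δ)) - 1 / (p a b * B a (b + 1))

end ZeroBalanced

end

noncomputable section

open Filter Topology Finset

namespace ZeroBalanced

/-! Put `w = 1 - x ^ c` and `κ = d / c > 1`, so that `1 - x ^ d = 1 - (1 - w) ^ κ`. Since A + B = p
- 1 is fixed, each function F(A, B; p; ·) depends only on s = -AB, which is `σ a b δ` for one
function and t = `β a b` for the other. Then G is `hypDiff` divided by w, a slope from the origin.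
It increases in w as soon as `hypDiff` is strictly convex (`strictConvexOn_hypDiff`), and `w`
decreases in `x`. Its end limits are the derivative at 0, which is C₁, and a difference of Gauss
sums, which is C₂.

For convexity, F' is a multiple of the zero-balanced series Z = `zbSeries`, and (1 - x) Z' is a
multiple of Y = `succSeries`. The second derivative combines Y_t(w) with Z_s and Y_s at z = 1 - (1 -
w)^κ. The bounds Z_s > Y_s and (1 - w)^κ Y_s(z) ≤ (1 - w) Y_t(w) (`rpow_mul_succSeries_le`) reduce
its positivity to a numerical inequality (`convexity_condition`). The second bound integrates a
comparison of logarithmic derivatives, which is Chebyshev's inequality for weighted averages.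

For δ between δ₁ and 0 one has C₁ < 0 < C₂, so the difference changes sign. -/

/-! ### Power series with bounded coefficients, and a Chebyshev inequality -/

theorem summable_mul_pow {u : ℕ → ℝ} (hu : ∀ n, |u n| ≤ 1) {x : ℝ} (hx : |x| < 1) :
    Summable fun n => u n * x ^ n := by
  refine Summable.of_norm_bounded (summable_geometric_of_lt_one (abs_nonneg x) hx) fun n => ?_
  rw [Real.norm_eq_abs, abs_mul, abs_pow]
  exact mul_le_of_le_one_left (by positivity) (hu n)

theorem summable_nat_mul_mul_pow {u : ℕ → ℝ} (hu : ∀ n, |u n| ≤ 1) {x : ℝ} (hx : |x| < 1) :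
    Summable fun n : ℕ => (n : ℝ) * u n * x ^ n := by
  have h1 : Summable fun n : ℕ => (n : ℝ) ^ 1 * |x| ^ n :=
    summable_pow_mul_geometric_of_norm_lt_one 1 (by simpa using hx)
  refine Summable.of_norm_bounded h1 fun n => ?_
  rw [Real.norm_eq_abs, abs_mul, abs_pow, abs_mul, Nat.abs_cast, pow_one]
  exact mul_le_mul_of_nonneg_right (mul_le_of_le_one_right (by positivity) (hu n)) (by positivity)

theorem hasDerivAt_tsum_mul_pow {u : ℕ → ℝ} (hu : ∀ n, |u n| ≤ 1) {x : ℝ} (hx : |x| < 1) :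
    HasDerivAt (fun y => ∑' n, u n * y ^ n) (∑' n : ℕ, (n : ℝ) * u n * x ^ (n - 1)) x := by
  obtain ⟨ρ, hxρ, hρ⟩ := exists_between hx
  have hρ0 : 0 < ρ := (abs_nonneg x).trans_lt hxρ
  have hsum : Summable fun n : ℕ => (n : ℝ) * ρ ^ (n - 1) := by
    have h1 : Summable fun n : ℕ => (n : ℝ) ^ 1 * ρ ^ n :=
      summable_pow_mul_geometric_of_norm_lt_one 1 (by rwa [Real.norm_of_nonneg hρ0.le])
    refine (h1.mul_right ρ⁻¹).congr fun n => ?_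
    cases n with
    | zero => simp
    | succ n => simp [pow_succ]; field_simp
  refine hasDerivAt_tsum_of_isPreconnected (g := fun n y => u n * y ^ n)
    (g' := fun n y => (n : ℝ) * u n * y ^ (n - 1)) (t := Ioo (-ρ) ρ) (y₀ := 0) hsum isOpen_Ioo
    isPreconnected_Ioo (fun n y _ => ?_) (fun n y hy => ?_) ⟨by linarith, hρ0⟩
    (summable_mul_pow hu (by simp)) (abs_lt.1 hxρ)
  · exact ((hasDerivAt_pow n y).const_mul (u n)).congr_deriv (by ring)
  · rw [Real.norm_eq_abs, abs_mul, abs_pow, abs_mul, Nat.abs_cast]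
    have hy' : |y| ≤ ρ := (abs_lt.2 hy).le
    have := pow_le_pow_left₀ (abs_nonneg y) hy' (n - 1)
    exact mul_le_mul (mul_le_of_le_one_right (by positivity) (hu n)) this (by positivity)
      (by positivity)

/-- The derivative of a power series, multiplied by `1 - x`. -/
theorem one_sub_mul_tsum_deriv {u : ℕ → ℝ} (hu : ∀ n, |u n| ≤ 1) {x : ℝ} (hx : |x| < 1) :
    (1 - x) * ∑' n : ℕ, (n : ℝ) * u n * x ^ (n - 1) =
      ∑' n : ℕ, ((n + 1) * u (n + 1) - n * u n) * x ^ n := by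
  have h0 := summable_nat_mul_mul_pow hu hx
  have h1 : Summable fun n : ℕ => ((n : ℝ) + 1) * u (n + 1) * x ^ n := by
    rcases eq_or_ne x 0 with rfl | hx0
    · exact summable_of_ne_finset_zero (s := {0}) fun n hn => by
        simp only [Finset.mem_singleton] at hn; simp [hn]
    · refine (((summable_nat_add_iff 1).2 h0).mul_right x⁻¹).congr fun n => ?_
      push_cast
      field_simp
      ring
  have h2 : ∑' n : ℕ, (n : ℝ) * u n * x ^ (n - 1) = ∑' n : ℕ, ((n : ℝ) + 1) * u (n + 1) * x ^ n := by
    rw [tsum_eq_zero_add']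
    · simp
    · simpa using h1
  have h3 : x * ∑' n : ℕ, (n : ℝ) * u n * x ^ (n - 1) = ∑' n : ℕ, (n : ℝ) * u n * x ^ n := by
    rw [← tsum_mul_left]
    refine tsum_congr fun n => ?_
    cases n with
    | zero => simp
    | succ n => simp [pow_succ]; ring
  rw [sub_mul, one_mul, h3, h2, ← h1.tsum_sub h0]
  exact tsum_congr fun n => by ring

/-- Chebyshev's inequality for averages with respect to two weights whose ratio is monotone. -/
theorem tsum_mul_tsum_le_of_ratio {v w e g : ℕ → ℝ} (hw : ∀ n, 0 ≤ w n) (hv : ∀ n, 0 ≤ v n)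
    (hr : ∀ m n, m ≤ n → w n * v m ≤ w m * v n)
    (he : ∀ m n, m ≤ n → e m ≤ e n) (hge : ∀ n, g n ≤ e n)
    (hsw : Summable w) (hsv : Summable v) (hsg : Summable fun n => g n * w n)
    (hse : Summable fun n => e n * v n) :
    (∑' n, g n * w n) * ∑' n, v n ≤ (∑' n, e n * v n) * ∑' n, w n := by
  refine le_of_tendsto_of_tendsto' (hsg.hasSum.tendsto_sum_nat.mul hsv.hasSum.tendsto_sum_nat)
    (hse.hasSum.tendsto_sum_nat.mul hsw.hasSum.tendsto_sum_nat) fun N => ?_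
  have h1 : (∑ n ∈ range N, g n * w n) * ∑ n ∈ range N, v n ≤
      (∑ n ∈ range N, e n * w n) * ∑ n ∈ range N, v n :=
    mul_le_mul_of_nonneg_right (sum_le_sum fun n _ => mul_le_mul_of_nonneg_right (hge n) (hw n))
      (sum_nonneg fun n _ => hv n)
  refine h1.trans ?_
  rw [sum_mul_sum, sum_mul_sum]
  -- Symmetrising the double sum in i and j leaves a product of two differences of equal sign for
  -- each pair.
  have h2 : ∀ f : ℕ → ℕ → ℝ, ∑ i ∈ range N, ∑ j ∈ range N, f i j =
      (∑ i ∈ range N, ∑ j ∈ range N, (f i j + f j i)) / 2 := by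
    intro f
    have : ∑ i ∈ range N, ∑ j ∈ range N, f j i = ∑ i ∈ range N, ∑ j ∈ range N, f i j := sum_comm
    simp only [sum_add_distrib, this]
    ring
  rw [h2, h2 fun i j => e i * v i * w j]
  gcongr ?_ / 2
  refine sum_le_sum fun i _ => sum_le_sum fun j _ => ?_
  rcases le_total i j with hij | hij
  · nlinarith [mul_nonneg (sub_nonneg.2 (he i j hij)) (sub_nonneg.2 (hr i j hij))]
  · nlinarith [mul_nonneg (sub_nonneg.2 (he j i hij)) (sub_nonneg.2 (hr j i hij))]

/-! ### The three hypergeometric series and their derivatives -/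

/-- Coefficients of the zero-balanced series `F(A + 1, B + 1; p + 1; x)` with `A + B = p - 1`
and `A * B = -s`. -/
def zbCoeff (p s : ℝ) (n : ℕ) : ℝ :=
  ∏ j ∈ range n, (((j : ℝ) + 1) ^ 2 + (p - 1) * (j + 1) - s) / ((p + 1 + j) * (j + 1))

/-- Coefficients of `F(A + 1, B + 1; p + 2; x)`. -/
def succCoeff (p s : ℝ) (n : ℕ) : ℝ := zbCoeff p s n * ((p + 1) / (p + 1 + n))

/-- Coefficients of `F(A, B; p; x)`. -/
def hypCoeff (p s : ℝ) : ℕ → ℝ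
  | 0 => 1
  | n + 1 => -(s / p) * (zbCoeff p s n / (n + 1))

/-- `F(A + 1, B + 1; p + 1; x)` with `A + B = p - 1` and `A * B = -s`. -/
def zbSeries (p s x : ℝ) : ℝ := ∑' n, zbCoeff p s n * x ^ n

/-- `F(A + 1, B + 1; p + 2; x)` with `A + B = p - 1` and `A * B = -s`. -/
def succSeries (p s x : ℝ) : ℝ := ∑' n, succCoeff p s n * x ^ n

/-- `F(A, B; p; x)` with `A + B = p - 1` and `A * B = -s`. -/
def hypSeries (p s x : ℝ) : ℝ := ∑' n, hypCoeff p s n * x ^ n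

/-- The derivative of `succSeries`. -/
def succSeriesDeriv (p s x : ℝ) : ℝ := ∑' n : ℕ, (n : ℝ) * succCoeff p s n * x ^ (n - 1)

theorem zbCoeff_zero (p s : ℝ) : zbCoeff p s 0 = 1 := by simp [zbCoeff]

theorem zbCoeff_succ (p s : ℝ) (n : ℕ) : zbCoeff p s (n + 1) = zbCoeff p s n *
    ((((n : ℝ) + 1) ^ 2 + (p - 1) * (n + 1) - s) / ((p + 1 + n) * (n + 1))) := by
  rw [zbCoeff, prod_range_succ, zbCoeff]

theorem zbFactor_pos {p s : ℝ} (hp : 1 ≤ p) (hs : s < p) (n : ℕ) :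
    0 < ((n : ℝ) + 1) ^ 2 + (p - 1) * (n + 1) - s := by
  have : (0 : ℝ) ≤ n := n.cast_nonneg
  nlinarith [mul_nonneg (sub_nonneg.2 hp) this]

theorem zbCoeff_pos {p s : ℝ} (hp : 1 ≤ p) (hs : s < p) (n : ℕ) : 0 < zbCoeff p s n := by
  refine prod_pos fun j _ => div_pos (zbFactor_pos hp hs j) ?_
  have : (0 : ℝ) ≤ j := j.cast_nonneg
  positivity

/-- The numerator of each factor is (j + 1)(j + p) - s, at most the denominator. -/
theorem zbCoeff_le_one {p s : ℝ} (hp : 1 ≤ p) (h0 : 0 ≤ s) (hs : s < p) (n : ℕ) :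
    zbCoeff p s n ≤ 1 := by
  refine prod_le_one (fun j _ => ?_) fun j _ => ?_ <;> have : (0 : ℝ) ≤ j := j.cast_nonneg
  · exact div_nonneg (zbFactor_pos hp hs j).le (by positivity)
  · rw [div_le_one (by positivity)]
    nlinarith

theorem succCoeff_pos {p s : ℝ} (hp : 1 ≤ p) (hs : s < p) (n : ℕ) : 0 < succCoeff p s n :=
  mul_pos (zbCoeff_pos hp hs n) (by positivity)

theorem succCoeff_le_zbCoeff {p s : ℝ} (hp : 1 ≤ p) (hs : s < p) (n : ℕ) :
    succCoeff p s n ≤ zbCoeff p s n := by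
  refine mul_le_of_le_one_right (zbCoeff_pos hp hs n).le ?_
  rw [div_le_one (by positivity)]
  have : (0 : ℝ) ≤ n := n.cast_nonneg
  linarith

theorem abs_zbCoeff_le {p s : ℝ} (hp : 1 ≤ p) (h0 : 0 ≤ s) (hs : s < p) (n : ℕ) :
    |zbCoeff p s n| ≤ 1 := by
  rw [abs_of_pos (zbCoeff_pos hp hs n)]
  exact zbCoeff_le_one hp h0 hs n

theorem abs_succCoeff_le {p s : ℝ} (hp : 1 ≤ p) (h0 : 0 ≤ s) (hs : s < p) (n : ℕ) :
    |succCoeff p s n| ≤ 1 := by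
  rw [abs_of_pos (succCoeff_pos hp hs n)]
  exact (succCoeff_le_zbCoeff hp hs n).trans (zbCoeff_le_one hp h0 hs n)

theorem abs_hypCoeff_le {p s : ℝ} (hp : 1 ≤ p) (h0 : 0 ≤ s) (hs : s < p) (n : ℕ) :
    |hypCoeff p s n| ≤ 1 := by
  cases n with
  | zero => simp [hypCoeff]
  | succ n =>
    have h1 : |s / p| ≤ 1 := by
      rw [abs_of_nonneg (by positivity), div_le_one (by positivity)]
      exact hs.le
    have h2 : |(zbCoeff p s n / (n + 1))| ≤ 1 := by
      rw [abs_div, div_le_one (by positivity), abs_of_pos (by positivity : (0 : ℝ) < n + 1)]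
      have : (0 : ℝ) ≤ n := n.cast_nonneg
      linarith [abs_zbCoeff_le hp h0 hs n]
    rw [hypCoeff, abs_mul, abs_neg]
    exact mul_le_one₀ h1 (abs_nonneg _) h2

theorem hasDerivAt_hypSeries {p s x : ℝ} (hp : 1 ≤ p) (h0 : 0 ≤ s) (hs : s < p) (hx : |x| < 1) :
    HasDerivAt (hypSeries p s) (-(s / p) * zbSeries p s x) x := by
  refine (hasDerivAt_tsum_mul_pow (abs_hypCoeff_le hp h0 hs) hx).congr_deriv ?_
  have h1 : ∀ n : ℕ, ((n + 1 : ℕ) : ℝ) * hypCoeff p s (n + 1) * x ^ (n + 1 - 1) =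
      -(s / p) * (zbCoeff p s n * x ^ n) := by
    intro n
    simp only [hypCoeff, add_tsub_cancel_right]
    push_cast
    field_simp
  rw [tsum_eq_zero_add']
  · simp only [h1, tsum_mul_left]
    simp [zbSeries]
  · simp only [h1]
    exact (summable_mul_pow (abs_zbCoeff_le hp h0 hs) hx).mul_left _

/-- Multiplying the derivative by 1 - x collapses its coefficients, because (n + 1)² + (p - 1)(n +
1) - s - n(p + 1 + n) = p - s. This is an instance of Euler's transformation. -/
theorem hasDerivAt_zbSeries {p s x : ℝ} (hp : 1 ≤ p) (h0 : 0 ≤ s) (hs : s < p) (hx : |x| < 1) :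
    HasDerivAt (zbSeries p s) ((p - s) / (p + 1) * succSeries p s x / (1 - x)) x := by
  refine (hasDerivAt_tsum_mul_pow (abs_zbCoeff_le hp h0 hs) hx).congr_deriv (Eq.symm ?_)
  have h1 := one_sub_mul_tsum_deriv (abs_zbCoeff_le hp h0 hs) hx
  have hx1 : 1 - x ≠ 0 := by linarith [(abs_lt.1 hx).2]
  rw [div_eq_iff hx1, mul_comm _ (1 - x), h1, succSeries, ← tsum_mul_left]
  refine tsum_congr fun n => ?_
  have h2 : p + 1 + (n : ℝ) ≠ 0 := by positivity
  rw [zbCoeff_succ, succCoeff]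
  field_simp
  ring

theorem hasDerivAt_succSeries {p s x : ℝ} (hp : 1 ≤ p) (h0 : 0 ≤ s) (hs : s < p) (hx : |x| < 1) :
    HasDerivAt (succSeries p s) (succSeriesDeriv p s x) x :=
  hasDerivAt_tsum_mul_pow (abs_succCoeff_le hp h0 hs) hx

theorem succCoeff_succ {p : ℝ} (hp : 1 ≤ p) (s : ℝ) (n : ℕ) : succCoeff p s (n + 1) =
    succCoeff p s n * ((((n : ℝ) + 1) ^ 2 + (p - 1) * (n + 1) - s) / ((p + 2 + n) * (n + 1))) := by
  have h2 : p + 1 + (n : ℝ) ≠ 0 := by positivity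
  have h3 : p + 2 + (n : ℝ) ≠ 0 := by positivity
  have h4 : p + 1 + ((n : ℝ) + 1) ≠ 0 := by positivity
  rw [succCoeff, succCoeff, zbCoeff_succ]
  push_cast
  field_simp
  ring

theorem summable_ratio_mul_succCoeff {p s x : ℝ} (hp : 1 ≤ p) (h0 : 0 ≤ s) (hs : s < p)
    (hx : |x| < 1) :
    Summable fun n : ℕ => (2 * n + 2 + s) / (p + 2 + n) * (succCoeff p s n * x ^ n) := by
  have h1 := (summable_mul_pow (abs_succCoeff_le hp h0 hs) hx).norm.mul_left 2
  refine Summable.of_norm_bounded h1 fun n => ?_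
  have hn : (0 : ℝ) ≤ n := n.cast_nonneg
  rw [norm_mul]
  refine mul_le_mul_of_nonneg_right ?_ (norm_nonneg _)
  rw [Real.norm_of_nonneg (by positivity), div_le_iff₀ (by positivity)]
  linarith

/-- After division by Y, the left side is a weighted average of (2n + 2 + s)/(p + 2 + n), the form
needed for Chebyshev's inequality. -/
theorem succSeries_sub_deriv {p s x : ℝ} (hp : 1 ≤ p) (h0 : 0 ≤ s) (hs : s < p) (hx : |x| < 1) :
    succSeries p s x - (1 - x) * succSeriesDeriv p s x =
      ∑' n : ℕ, (2 * n + 2 + s) / (p + 2 + n) * (succCoeff p s n * x ^ n) := by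
  rw [succSeriesDeriv, one_sub_mul_tsum_deriv (abs_succCoeff_le hp h0 hs) hx, sub_eq_iff_eq_add']
  have h1 := summable_mul_pow (abs_succCoeff_le hp h0 hs) hx
  have h2 := summable_ratio_mul_succCoeff hp h0 hs hx
  have key : ∀ n : ℕ, ((n + 1) * succCoeff p s (n + 1) - n * succCoeff p s n) * x ^ n =
      succCoeff p s n * x ^ n - (2 * n + 2 + s) / (p + 2 + n) * (succCoeff p s n * x ^ n) := by
    intro n
    have h3 : p + 2 + (n : ℝ) ≠ 0 := by positivity
    rw [succCoeff_succ hp]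
    field_simp
    ring
  simp only [key]
  rw [h1.tsum_sub h2]
  simp [succSeries]

theorem succSeries_pos {p s x : ℝ} (hp : 1 ≤ p) (h0 : 0 ≤ s) (hs : s < p) (hx : x ∈ Ico (0 : ℝ) 1) :
    0 < succSeries p s x := by
  have hx' : |x| < 1 := by rw [abs_of_nonneg hx.1]; exact hx.2
  refine (summable_mul_pow (abs_succCoeff_le hp h0 hs) hx').tsum_pos
    (fun n => mul_nonneg (succCoeff_pos hp hs n).le (pow_nonneg hx.1 n)) 0 ?_
  simpa using succCoeff_pos hp hs 0

theorem succSeries_lt_zbSeries {p s x : ℝ} (hp : 1 ≤ p) (h0 : 0 ≤ s) (hs : s < p)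
    (hx : x ∈ Ioo (0 : ℝ) 1) : succSeries p s x < zbSeries p s x := by
  have hx' : |x| < 1 := by rw [abs_of_pos hx.1]; exact hx.2
  refine Summable.tsum_lt_tsum (i := 1)
    (fun n => mul_le_mul_of_nonneg_right (succCoeff_le_zbCoeff hp hs n) (pow_nonneg hx.1.le n)) ?_
    (summable_mul_pow (abs_succCoeff_le hp h0 hs) hx')
    (summable_mul_pow (abs_zbCoeff_le hp h0 hs) hx')
  refine mul_lt_mul_of_pos_right ?_ (pow_pos hx.1 1)
  refine mul_lt_of_lt_one_right (zbCoeff_pos hp hs 1) ?_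
  rw [div_lt_one (by positivity)]
  push_cast
  linarith

/-! ### Comparison of two parameters s ≤ t -/

theorem succCoeff_ratio {p s t : ℝ} (hp : 1 ≤ p) (hst : s ≤ t) (ht : t < p) {m n : ℕ}
    (hmn : m ≤ n) : succCoeff p t n * succCoeff p s m ≤ succCoeff p t m * succCoeff p s n := by
  induction n, hmn using Nat.le_induction with
  | base => exact le_rfl
  | succ n _ ih =>
    rw [succCoeff_succ hp, succCoeff_succ hp]
    have hf := zbFactor_pos hp ht n
    have hg := zbFactor_pos hp (hst.trans_lt ht) n
    have hle : (((n : ℝ) + 1) ^ 2 + (p - 1) * (n + 1) - t) / ((p + 2 + n) * (n + 1)) ≤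
        (((n : ℝ) + 1) ^ 2 + (p - 1) * (n + 1) - s) / ((p + 2 + n) * (n + 1)) := by gcongr
    calc _ = succCoeff p t n * succCoeff p s m *
          ((((n : ℝ) + 1) ^ 2 + (p - 1) * (n + 1) - t) / ((p + 2 + n) * (n + 1))) := by ring
      _ ≤ succCoeff p t m * succCoeff p s n *
          ((((n : ℝ) + 1) ^ 2 + (p - 1) * (n + 1) - s) / ((p + 2 + n) * (n + 1))) :=
        mul_le_mul ih hle (by positivity)
          (mul_nonneg (succCoeff_pos hp ht m).le (succCoeff_pos hp (hst.trans_lt ht) n).le)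
      _ = _ := by ring

/-- Comparison of the logarithmic derivatives of two of the series at two points. -/
theorem logDeriv_succSeries_compare {p s t r w z : ℝ} (hp : 1 ≤ p) (h0 : 0 ≤ s) (hst : s ≤ t)
    (ht : t < p) (hr0 : 0 ≤ r) (hr : r * (2 + t) ≤ 2) (hw : 0 ≤ w) (hwz : w ≤ z) (hz : z < 1) :
    r * (succSeries p t w - (1 - w) * succSeriesDeriv p t w) * succSeries p s z ≤
      (succSeries p s z - (1 - z) * succSeriesDeriv p s z) * succSeries p t w := by
  have hw' : |w| < 1 := by rw [abs_of_nonneg hw]; linarith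
  have hz' : |z| < 1 := by rw [abs_of_nonneg (hw.trans hwz)]; exact hz
  have hsp := hst.trans_lt ht
  have ht0 := h0.trans hst
  have hr1 : r ≤ 1 := by nlinarith
  rw [succSeries_sub_deriv hp ht0 ht hw', succSeries_sub_deriv hp h0 hsp hz', ← tsum_mul_left]
  have hsg := (summable_ratio_mul_succCoeff hp ht0 ht hw').mul_left r
  simp only [← mul_assoc r] at hsg ⊢
  refine tsum_mul_tsum_le_of_ratio
    (fun n => mul_nonneg (succCoeff_pos hp ht n).le (pow_nonneg hw n))
    (fun n => mul_nonneg (succCoeff_pos hp hsp n).le (pow_nonneg (hw.trans hwz) n))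
    (fun m n hmn => ?_) (fun m n hmn => ?_) (fun n => ?_)
    (summable_mul_pow (abs_succCoeff_le hp ht0 ht) hw')
    (summable_mul_pow (abs_succCoeff_le hp h0 hsp) hz') hsg
    (summable_ratio_mul_succCoeff hp h0 hsp hz')
  · obtain ⟨i, rfl⟩ := Nat.exists_eq_add_of_le hmn
    have h1 := succCoeff_ratio hp hst ht hmn
    have h2 := pow_le_pow_left₀ hw hwz i
    have h3 : 0 ≤ w ^ m * z ^ m := mul_nonneg (pow_nonneg hw m) (pow_nonneg (hw.trans hwz) m)
    have h4 := mul_le_mul h1 h2 (pow_nonneg hw i)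
      (mul_nonneg (succCoeff_pos hp ht m).le (succCoeff_pos hp hsp (m + i)).le)
    calc _ = succCoeff p t (m + i) * succCoeff p s m * w ^ i * (w ^ m * z ^ m) := by ring
      _ ≤ succCoeff p t m * succCoeff p s (m + i) * z ^ i * (w ^ m * z ^ m) :=
        mul_le_mul_of_nonneg_right h4 h3
      _ = _ := by ring
  · have h1 : (m : ℝ) ≤ n := by exact_mod_cast hmn
    have h2 : (0 : ℝ) ≤ m := m.cast_nonneg
    rw [div_le_div_iff₀ (by positivity) (by positivity)]
    nlinarith
  · rw [← mul_div_assoc]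
    have h2 : (0 : ℝ) ≤ n := n.cast_nonneg
    refine div_le_div_of_nonneg_right ?_ (by positivity)
    nlinarith

/-! ### Identification with F and Gauss's value at 1 -/

theorem hypCoeff_succ {p : ℝ} (hp : 1 ≤ p) (s : ℝ) (n : ℕ) : hypCoeff p s (n + 1) =
    hypCoeff p s n * (((n : ℝ) ^ 2 + (p - 1) * n - s) / ((p + n) * (n + 1))) := by
  cases n with
  | zero =>
    simp [hypCoeff, zbCoeff_zero, neg_div]
  | succ n =>
    have h1 : p + 1 + (n : ℝ) ≠ 0 := by positivity
    have h2 : p + ((n : ℝ) + 1) ≠ 0 := by positivity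
    rw [hypCoeff, hypCoeff, zbCoeff_succ]
    push_cast
    field_simp
    ring

theorem F_eq_hypSeries {A B p : ℝ} (hp : 1 ≤ p) (hAB : A + B = p - 1) (x : ℝ) :
    F A B p x = hypSeries p (-(A * B)) x := by
  have key : ∀ n : ℕ, ((n.factorial : ℝ)⁻¹ * (ascPochhammer ℝ n).eval A *
      (ascPochhammer ℝ n).eval B * ((ascPochhammer ℝ n).eval p)⁻¹) =
        hypCoeff p (-(A * B)) n := by
    intro n
    induction n with
    | zero => simp [hypCoeff]
    | succ n ih =>
      rw [hypCoeff_succ hp, ← ih]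
      simp only [ascPochhammer_succ_eval, Nat.factorial_succ, mul_inv, Nat.cast_mul]
      have h2 : (n : ℝ) ^ 2 + (p - 1) * n - -(A * B) = (A + n) * (B + n) := by
        rw [← hAB]; ring
      rw [h2]
      push_cast
      field_simp
  rw [F, ordinaryHypergeometric_eq_tsum]
  simp only [key, smul_eq_mul]
  rfl

/-- The partial sums at x = 1 have a closed product form, so Abel's theorem only requires the limit
of a Gamma-type product. -/
theorem sum_hypCoeff {p : ℝ} (hp : 1 ≤ p) (s : ℝ) (n : ℕ) :
    ∑ i ∈ range (n + 1), hypCoeff p s i = zbCoeff p s n * ((p + n) / p) := by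
  have hp0 : p ≠ 0 := by positivity
  induction n with
  | zero => simp [hypCoeff, zbCoeff_zero, hp0]
  | succ n ih =>
    have h1 : p + 1 + (n : ℝ) ≠ 0 := by positivity
    rw [sum_range_succ, ih, hypCoeff, zbCoeff_succ]
    push_cast
    field_simp
    ring

theorem zbCoeff_mul_eq_prod {A B p : ℝ} (hp : 1 ≤ p) (hAB : A + B = p - 1) (n : ℕ) :
    zbCoeff p (-(A * B)) n * ((p + n) / p) =
      (∏ j ∈ range n, (A + 1 + j)) * (∏ j ∈ range n, (B + 1 + j)) /
        ((∏ j ∈ range n, (p + j)) * ∏ j ∈ range n, (1 + (j : ℝ))) := by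
  have hp0 : p ≠ 0 := by positivity
  rw [← prod_mul_distrib, ← prod_mul_distrib, ← prod_div_distrib]
  induction n with
  | zero => simp [zbCoeff_zero, hp0]
  | succ n ih =>
    have h1 : p + 1 + (n : ℝ) ≠ 0 := by positivity
    have h2 : p + (n : ℝ) ≠ 0 := by positivity
    have h4 : 1 + (n : ℝ) ≠ 0 := by positivity
    have h3 : ((n : ℝ) + 1) ^ 2 + (p - 1) * (n + 1) - -(A * B) = (A + 1 + n) * (B + 1 + n) := by
      rw [← hAB]; ring
    rw [prod_range_succ, ← ih, zbCoeff_succ, h3]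
    push_cast
    field_simp
    ring

/-- The value `F(A, B; p; 1)` with `A + B = p - 1`. -/
def gaussValue (p A B : ℝ) : ℝ :=
  Real.Gamma p / (Real.Gamma (A + 1) * Real.Gamma (B + 1))

theorem tendsto_zbCoeff_mul {A B p : ℝ} (hp : 1 ≤ p) (hAB : A + B = p - 1) (hA : 0 < A + 1)
    (hB : 0 < B + 1) :
    Tendsto (fun n : ℕ => zbCoeff p (-(A * B)) n * ((p + n) / p)) atTop
      (𝓝 (gaussValue p A B)) := by
  have hΓ : Real.Gamma (A + 1) * Real.Gamma (B + 1) ≠ 0 :=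
    (mul_pos (Real.Gamma_pos_of_pos hA) (Real.Gamma_pos_of_pos hB)).ne'
  have h1 := ((Real.GammaSeq_tendsto_Gamma p).mul (Real.GammaSeq_tendsto_Gamma 1)).div
    ((Real.GammaSeq_tendsto_Gamma (A + 1)).mul (Real.GammaSeq_tendsto_Gamma (B + 1))) hΓ
  rw [Real.Gamma_one, mul_one] at h1
  -- The products in `Real.GammaSeq` at index n have n + 1 factors.
  rw [← tendsto_add_atTop_iff_nat 1]
  refine h1.congr' ?_
  filter_upwards [eventually_gt_atTop 0] with n hn
  have hn' : (0 : ℝ) < n := by exact_mod_cast hn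
  have hpos : ∀ y : ℝ, 0 < y → (∏ j ∈ range (n + 1), (y + (j : ℝ))) ≠ 0 := fun y hy =>
    (prod_pos fun j _ => by positivity).ne'
  -- The powers of n cancel because p + 1 = (A + 1) + (B + 1).
  have hpow : (n : ℝ) ^ p * (n : ℝ) ^ (1 : ℝ) = (n : ℝ) ^ (A + 1) * (n : ℝ) ^ (B + 1) := by
    rw [← Real.rpow_add hn', ← Real.rpow_add hn']
    congr 1
    linarith
  have a1 := hpos p (by positivity)
  have a2 := hpos 1 one_pos
  have a3 := hpos _ hA
  have a4 := hpos _ hB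
  have hf : (n.factorial : ℝ) ≠ 0 := by positivity
  have b1 : (n : ℝ) ^ (A + 1) ≠ 0 := by positivity
  have b2 : (n : ℝ) ^ (B + 1) ≠ 0 := by positivity
  rw [zbCoeff_mul_eq_prod hp hAB]
  simp only [Pi.div_apply, Real.GammaSeq]
  generalize (∏ j ∈ range (n + 1), (p + (j : ℝ))) = p1 at *
  generalize (∏ j ∈ range (n + 1), (1 + (j : ℝ))) = p2 at *
  generalize (∏ j ∈ range (n + 1), (A + 1 + (j : ℝ))) = p3 at *
  generalize (∏ j ∈ range (n + 1), (B + 1 + (j : ℝ))) = p4 at *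
  rw [div_mul_div_comm, div_mul_div_comm, div_div_div_eq, div_eq_div_iff (by positivity)
    (by positivity)]
  linear_combination (n.factorial : ℝ) ^ 2 * p3 * p4 * p1 * p2 * hpow

/-- Gauss's summation theorem for `F(A, B; A + B + 1; x)`, as a limit. -/
theorem tendsto_hypSeries_one {A B p : ℝ} (hp : 1 ≤ p) (hAB : A + B = p - 1) (hA : 0 < A + 1)
    (hB : 0 < B + 1) :
    Tendsto (hypSeries p (-(A * B))) (𝓝[<] 1) (𝓝 (gaussValue p A B)) := by
  refine Real.tendsto_tsum_powerSeries_nhdsWithin_lt ?_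
  rw [← tendsto_add_atTop_iff_nat 1]
  simp only [sum_hypCoeff hp]
  exact tendsto_zbCoeff_mul hp hAB hA hB

/-- The j = 0 factors are in the exact ratio (p - t)/(p - s), and every later factor is smaller for
t. Keeping this ratio explicit preserves strictness in the limit. -/
theorem zbCoeff_compare {p s t : ℝ} (hp : 1 ≤ p) (hst : s ≤ t) (ht : t < p) (n : ℕ) :
    zbCoeff p t (n + 1) * (p - s) ≤ zbCoeff p s (n + 1) * (p - t) := by
  induction n with
  | zero =>
    simp only [zbCoeff_succ, zbCoeff_zero]
    refine le_of_eq ?_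
    push_cast
    field_simp
    ring
  | succ n ih =>
    rw [zbCoeff_succ p t (n + 1), zbCoeff_succ p s (n + 1)]
    have hf := zbFactor_pos hp ht (n + 1)
    have hle : ((((n + 1 : ℕ) : ℝ) + 1) ^ 2 + (p - 1) * ((n + 1 : ℕ) + 1) - t) /
          ((p + 1 + (n + 1 : ℕ)) * ((n + 1 : ℕ) + 1)) ≤
        ((((n + 1 : ℕ) : ℝ) + 1) ^ 2 + (p - 1) * ((n + 1 : ℕ) + 1) - s) /
          ((p + 1 + (n + 1 : ℕ)) * ((n + 1 : ℕ) + 1)) := by gcongr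
    rw [mul_right_comm, mul_right_comm (zbCoeff p s (n + 1))]
    exact mul_le_mul ih hle (by positivity)
      (mul_nonneg (zbCoeff_pos hp (hst.trans_lt ht) _).le (by linarith))

theorem gaussValue_pos {A B p : ℝ} (hp : 1 ≤ p) (hA : 0 < A + 1) (hB : 0 < B + 1) :
    0 < gaussValue p A B :=
  div_pos (Real.Gamma_pos_of_pos (by positivity))
    (mul_pos (Real.Gamma_pos_of_pos hA) (Real.Gamma_pos_of_pos hB))

theorem gaussValue_lt {A B A' B' p : ℝ} (hp : 1 ≤ p) (hAB : A + B = p - 1) (hA : 0 < A + 1)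
    (hB : 0 < B + 1) (hAB' : A' + B' = p - 1) (hA' : 0 < A' + 1) (hB' : 0 < B' + 1)
    (hlt : A * B < A' * B') : gaussValue p A B < gaussValue p A' B' := by
  have ht : -(A * B) < p := by nlinarith [mul_pos hA hB]
  have h1 := ((tendsto_zbCoeff_mul hp hAB hA hB).comp (tendsto_add_atTop_nat 1)).mul_const
    (p - -(A' * B'))
  have h2 := ((tendsto_zbCoeff_mul hp hAB' hA' hB').comp (tendsto_add_atTop_nat 1)).mul_const
    (p - -(A * B))
  have h3 := le_of_tendsto_of_tendsto' h1 h2 fun n => by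
    have := mul_le_mul_of_nonneg_right (zbCoeff_compare hp (neg_lt_neg hlt).le ht n)
      (by positivity : 0 ≤ (p + ((n + 1 : ℕ) : ℝ)) / p)
    simp only [Function.comp_apply]
    linarith
  have h4 := gaussValue_pos hp hA hB
  nlinarith

/-! ### The substitution z = 1 - (1 - w)^κ and the key inequality -/

theorem hasDerivAt_one_sub_rpow (κ : ℝ) {w : ℝ} (hw : w < 1) :
    HasDerivAt (fun y : ℝ => (1 - y) ^ κ) (-(κ * (1 - w) ^ (κ - 1))) w := by
  have h1 : HasDerivAt (fun y : ℝ => 1 - y) (-1) w := by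
    simpa using (hasDerivAt_id w).const_sub 1
  exact (h1.rpow_const (Or.inl (by linarith))).congr_deriv (by ring)

theorem hasDerivAt_one_sub_one_sub_rpow (κ : ℝ) {w : ℝ} (hw : w < 1) :
    HasDerivAt (fun y : ℝ => 1 - (1 - y) ^ κ) (κ * (1 - w) ^ (κ - 1)) w :=
  ((hasDerivAt_one_sub_rpow κ hw).const_sub 1).congr_deriv (neg_neg _)

theorem le_one_sub_one_sub_rpow {κ w : ℝ} (hκ : 1 ≤ κ) (hw : w ∈ Ico (0 : ℝ) 1) :
    w ≤ 1 - (1 - w) ^ κ := by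
  have := Real.rpow_le_rpow_of_exponent_ge (by linarith [hw.2] : 0 < 1 - w) (by linarith [hw.1]) hκ
  rw [Real.rpow_one] at this
  linarith

theorem one_sub_one_sub_rpow_lt_one {κ w : ℝ} (hw : w < 1) : 1 - (1 - w) ^ κ < 1 := by
  have := Real.rpow_pos_of_pos (sub_pos.2 hw) κ
  linarith

theorem abs_lt_one_of_mem_Ico {x : ℝ} (hx : x ∈ Ico (0 : ℝ) 1) : |x| < 1 := by
  rw [abs_of_nonneg hx.1]
  exact hx.2

theorem one_sub_one_sub_rpow_mem {κ w : ℝ} (hκ : 1 ≤ κ) (hw : w ∈ Ico (0 : ℝ) 1) :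
    1 - (1 - w) ^ κ ∈ Ico (0 : ℝ) 1 :=
  ⟨hw.1.trans (le_one_sub_one_sub_rpow hκ hw), one_sub_one_sub_rpow_lt_one hw.2⟩

/-- Both sides equal 1 at w = 0, and the logarithm of their ratio is monotone: its derivative has
the sign given by `logDeriv_succSeries_compare` at w ≤ z with r = 1/κ. -/
theorem rpow_mul_succSeries_le {p s t κ w : ℝ} (hp : 1 ≤ p) (h0 : 0 ≤ s) (hst : s ≤ t)
    (ht : t < p) (hκ : 1 ≤ κ) (hκt : 2 + t ≤ 2 * κ) (hw : w ∈ Ico (0 : ℝ) 1) :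
    (1 - w) ^ κ * succSeries p s (1 - (1 - w) ^ κ) ≤ (1 - w) * succSeries p t w := by
  have hκ0 : 0 < κ := by linarith
  have ht0 := h0.trans hst
  have hs := hst.trans_lt ht
  set ℓ : ℝ → ℝ := fun y => Real.log (1 - y) + Real.log (succSeries p t y) -
    (κ * Real.log (1 - y) + Real.log (succSeries p s (1 - (1 - y) ^ κ))) with hℓ
  have hd : ∀ y ∈ Ico (0 : ℝ) 1, HasDerivAt ℓ
      (-1 / (1 - y) + succSeriesDeriv p t y / succSeries p t y - (κ * (-1 / (1 - y)) +
        succSeriesDeriv p s (1 - (1 - y) ^ κ) * (κ * (1 - y) ^ (κ - 1)) /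
          succSeries p s (1 - (1 - y) ^ κ))) y := by
    intro y hy
    have hz := one_sub_one_sub_rpow_mem hκ hy
    have h1 : HasDerivAt (fun y : ℝ => 1 - y) (-1) y := by
      simpa using (hasDerivAt_id y).const_sub 1
    have h2 := h1.log (by linarith [hy.2] : (1 : ℝ) - y ≠ 0)
    have h3 := (hasDerivAt_succSeries hp ht0 ht (abs_lt_one_of_mem_Ico hy)).log
      (succSeries_pos hp ht0 ht hy).ne'
    have h4 : HasDerivAt (fun y => succSeries p s (1 - (1 - y) ^ κ))
        (succSeriesDeriv p s (1 - (1 - y) ^ κ) * (κ * (1 - y) ^ (κ - 1))) y :=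
      HasDerivAt.comp (h₂ := succSeries p s) (h := fun y => 1 - (1 - y) ^ κ) y
        (hasDerivAt_succSeries hp h0 hs (abs_lt_one_of_mem_Ico hz))
        (hasDerivAt_one_sub_one_sub_rpow κ hy.2)
    replace h4 := h4.log (succSeries_pos hp h0 hs hz).ne'
    exact (h2.add h3).sub ((h2.const_mul κ).add h4)
  have hmono : MonotoneOn ℓ (Ico 0 1) := by
    refine monotoneOn_of_deriv_nonneg (convex_Ico 0 1)
      (fun y hy => (hd y hy).continuousAt.continuousWithinAt)
      (fun y hy => (hd y (interior_subset hy)).differentiableAt.differentiableWithinAt)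
      fun y hy => ?_
    have hy' := interior_subset hy
    rw [(hd y hy').deriv]
    have hz := one_sub_one_sub_rpow_mem hκ hy'
    have hm : 0 < 1 - y := by linarith [hy'.2]
    have hYt := succSeries_pos hp ht0 ht hy'
    have hYs := succSeries_pos hp h0 hs hz
    have hcmp := logDeriv_succSeries_compare (r := κ⁻¹) hp h0 hst ht (by positivity)
      (by rw [inv_mul_le_iff₀ hκ0]; linarith) hy'.1 (le_one_sub_one_sub_rpow hκ hy') hz.2
    rw [mul_assoc, inv_mul_le_iff₀ hκ0, sub_sub_cancel] at hcmp
    have hM : (1 - y) ^ (κ - 1) = (1 - y) ^ κ / (1 - y) := by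
      rw [Real.rpow_sub hm, Real.rpow_one]
    rw [hM]
    generalize (1 - y) ^ κ = M at *
    generalize succSeries p s (1 - M) = Ys at *
    generalize succSeriesDeriv p s (1 - M) = Ys' at *
    generalize succSeries p t y = Yt at *
    generalize succSeriesDeriv p t y = Yt' at *
    have : -1 / (1 - y) + Yt' / Yt - (κ * (-1 / (1 - y)) + Ys' * (κ * (M / (1 - y))) / Ys) =
        (κ * ((Ys - M * Ys') * Yt) - (Yt - (1 - y) * Yt') * Ys) / ((1 - y) * Yt * Ys) := by
      field_simp
      ring
    rw [this]
    exact div_nonneg (sub_nonneg.2 hcmp) (by positivity)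
  have h0mem : (0 : ℝ) ∈ Ico (0 : ℝ) 1 := ⟨le_rfl, one_pos⟩
  have hle := hmono h0mem hw hw.1
  have hz := one_sub_one_sub_rpow_mem hκ hw
  have hm : 0 < 1 - w := by linarith [hw.2]
  have hYt := succSeries_pos hp ht0 ht hw
  have hYs := succSeries_pos hp h0 hs hz
  have hzero : ∀ u, succSeries p u 0 = 1 := fun u => by
    rw [succSeries, tsum_eq_single 0 fun n hn => by simp [hn]]
    have : p + 1 ≠ 0 := by positivity
    simp [succCoeff, zbCoeff_zero, this]
  simp only [hℓ, sub_zero, Real.log_one, Real.one_rpow, sub_self, hzero, mul_zero, add_zero] at hle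
  rw [← Real.log_le_log_iff (by positivity) (by positivity), Real.log_mul (by positivity) hYs.ne',
    Real.log_mul hm.ne' hYt.ne', Real.log_rpow hm]
  linarith

/-! ### Strict convexity of the difference and monotonicity of its slope -/

/-- The difference of the two hypergeometric functions, as a function of `w = 1 - x ^ c`. -/
def hypDiff (p s t κ w : ℝ) : ℝ := hypSeries p s (1 - (1 - w) ^ κ) - hypSeries p t w

/-- The derivative of `hypDiff`. -/
def hypDiffDeriv (p s t κ w : ℝ) : ℝ :=
  -(s / p) * (zbSeries p s (1 - (1 - w) ^ κ) * (κ * (1 - w) ^ (κ - 1))) + t / p * zbSeries p t w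

theorem hasDerivAt_hypDiff {p s t κ w : ℝ} (hp : 1 ≤ p) (h0 : 0 ≤ s) (hs : s < p) (ht0 : 0 ≤ t)
    (ht : t < p) (hκ : 1 ≤ κ) (hw : w ∈ Ico (0 : ℝ) 1) :
    HasDerivAt (hypDiff p s t κ) (hypDiffDeriv p s t κ w) w := by
  have hz := one_sub_one_sub_rpow_mem hκ hw
  have h1 := ((hasDerivAt_hypSeries hp h0 hs (abs_lt_one_of_mem_Ico hz)).comp w
    (hasDerivAt_one_sub_one_sub_rpow κ hw.2)).sub
    (hasDerivAt_hypSeries hp ht0 ht (abs_lt_one_of_mem_Ico hw))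
  exact h1.congr_deriv (by rw [hypDiffDeriv]; ring)

theorem hasDerivAt_hypDiffDeriv {p s t κ w : ℝ} (hp : 1 ≤ p) (h0 : 0 ≤ s) (hs : s < p)
    (ht0 : 0 ≤ t) (ht : t < p) (hκ : 1 ≤ κ) (hw : w ∈ Ico (0 : ℝ) 1) :
    HasDerivAt (hypDiffDeriv p s t κ)
      ((1 - w) ^ κ / (p * (p + 1) * (1 - w) ^ 2) *
        (t * (p - t) * ((1 - w) * succSeries p t w / (1 - w) ^ κ) +
          s * (κ * (κ - 1) * (p + 1) * zbSeries p s (1 - (1 - w) ^ κ) -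
            κ ^ 2 * (p - s) * succSeries p s (1 - (1 - w) ^ κ)))) w := by
  have hz := one_sub_one_sub_rpow_mem hκ hw
  have h1 := (hasDerivAt_zbSeries hp h0 hs (abs_lt_one_of_mem_Ico hz)).comp w
    (hasDerivAt_one_sub_one_sub_rpow κ hw.2)
  have h2 := (hasDerivAt_one_sub_rpow (κ - 1) hw.2).const_mul κ
  have h3 := hasDerivAt_zbSeries hp ht0 ht (abs_lt_one_of_mem_Ico hw)
  refine (((h1.mul h2).const_mul (-(s / p))).add (h3.const_mul (t / p))).congr_deriv ?_
  have hm : 0 < 1 - w := by linarith [hw.2]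
  have hM1 : (1 - w) ^ (κ - 1) = (1 - w) ^ κ / (1 - w) := by
    rw [Real.rpow_sub hm, Real.rpow_one]
  have hM2 : (1 - w) ^ (κ - 1 - 1) = (1 - w) ^ κ / (1 - w) ^ 2 := by
    rw [Real.rpow_sub hm, Real.rpow_one, hM1, div_div, sq]
  have hM := Real.rpow_pos_of_pos hm κ
  simp only [Function.comp_apply, hM1, hM2, sub_sub_cancel]
  generalize (1 - w) ^ κ = M at *
  have hp1 : p + 1 ≠ 0 := by positivity
  field_simp
  ring

/-- Replacing (1 - w) Y_t(w)/(1 - w)^κ and Z_s(z) by the smaller Y_s(z) bounds the bracket in the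
second derivative strictly below by Y_s(z) times the quantity in `hE`. -/
theorem strictConvexOn_hypDiff {p s t κ : ℝ} (hp : 1 ≤ p) (h0 : 0 < s) (hst : s ≤ t)
    (ht : t < p) (hκ : 1 < κ) (hκt : 2 + t ≤ 2 * κ)
    (hE : 0 ≤ t * (p - t) + s * (κ * (κ - 1) * (p + 1) - κ ^ 2 * (p - s))) :
    StrictConvexOn ℝ (Ico 0 1) (hypDiff p s t κ) := by
  have ht0 := h0.le.trans hst
  have hs := hst.trans_lt ht
  refine StrictMonoOn.strictConvexOn_of_deriv (convex_Ico 0 1)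
    (fun w hw => (hasDerivAt_hypDiff hp h0.le hs ht0 ht hκ.le hw).continuousAt.continuousWithinAt)
    ?_
  rw [interior_Ico]
  have hmono : StrictMonoOn (hypDiffDeriv p s t κ) (Ioo 0 1) := by
    refine strictMonoOn_of_deriv_pos (convex_Ioo 0 1) (fun w hw => (hasDerivAt_hypDiffDeriv hp h0.le
      hs ht0 ht hκ.le (Ioo_subset_Ico_self hw)).continuousAt.continuousWithinAt) fun w hw => ?_
    rw [interior_Ioo] at hw
    have hw' := Ioo_subset_Ico_self hw
    rw [(hasDerivAt_hypDiffDeriv hp h0.le hs ht0 ht hκ.le hw').deriv]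
    have hm : 0 < 1 - w := by linarith [hw.2]
    have hM := Real.rpow_pos_of_pos hm κ
    have hz : 1 - (1 - w) ^ κ ∈ Ioo (0 : ℝ) 1 :=
      ⟨hw.1.trans_le (le_one_sub_one_sub_rpow hκ.le hw'), one_sub_one_sub_rpow_lt_one hw.2⟩
    refine mul_pos (by positivity) ?_
    have hle := rpow_mul_succSeries_le hp h0.le hst ht hκ.le hκt hw'
    rw [mul_comm, ← le_div_iff₀ hM] at hle
    have hYZ := succSeries_lt_zbSeries hp h0.le hs hz
    have hY := succSeries_pos hp h0.le hs (Ioo_subset_Ico_self hz)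
    have h1 := mul_le_mul_of_nonneg_left hle (mul_nonneg ht0 (sub_nonneg.2 ht.le))
    have hk : 0 < s * (κ * (κ - 1) * (p + 1)) := by
      have := sub_pos.2 hκ
      positivity
    have h2 := mul_lt_mul_of_pos_left hYZ hk
    have h3 := mul_nonneg hE hY.le
    linarith
  refine hmono.congr fun w hw => ?_
  exact (hasDerivAt_hypDiff hp h0.le hs ht0 ht hκ.le (Ioo_subset_Ico_self hw)).deriv.symm

theorem hypSeries_zero (p s : ℝ) : hypSeries p s 0 = 1 := by
  rw [hypSeries, tsum_eq_single 0 fun n hn => by simp [hn]]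
  simp [hypCoeff]

theorem hypDiff_zero (p s t κ : ℝ) : hypDiff p s t κ 0 = 0 := by
  simp [hypDiff, hypSeries_zero]

theorem zbSeries_zero (p s : ℝ) : zbSeries p s 0 = 1 := by
  rw [zbSeries, tsum_eq_single 0 fun n hn => by simp [hn]]
  simp [zbCoeff_zero]

theorem strictMonoOn_hypDiff_div {p s t κ : ℝ} (hp : 1 ≤ p) (h0 : 0 < s) (hst : s ≤ t)
    (ht : t < p) (hκ : 1 < κ) (hκt : 2 + t ≤ 2 * κ)
    (hE : 0 ≤ t * (p - t) + s * (κ * (κ - 1) * (p + 1) - κ ^ 2 * (p - s))) :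
    StrictMonoOn (fun w => hypDiff p s t κ w / w) (Ioo 0 1) := by
  intro x hx y hy hxy
  have := (strictConvexOn_hypDiff hp h0 hst ht hκ hκt hE).secant_strict_mono (a := 0)
    ⟨le_rfl, one_pos⟩ (Ioo_subset_Ico_self hx) (Ioo_subset_Ico_self hy) hx.1.ne' hy.1.ne' hxy
  simpa [hypDiff_zero] using this

theorem continuousOn_hypDiff_div {p s t κ : ℝ} (hp : 1 ≤ p) (h0 : 0 ≤ s) (hs : s < p)
    (ht0 : 0 ≤ t) (ht : t < p) (hκ : 1 ≤ κ) :
    ContinuousOn (fun w => hypDiff p s t κ w / w) (Ioo 0 1) := fun _ hw =>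
  ((hasDerivAt_hypDiff hp h0 hs ht0 ht hκ (Ioo_subset_Ico_self hw)).continuousAt.div
    continuousAt_id hw.1.ne').continuousWithinAt

/-! ### Limits at the endpoints and the image of the interval -/

theorem tendsto_hypDiff_div_zero {p s t κ : ℝ} (hp : 1 ≤ p) (h0 : 0 ≤ s) (hs : s < p)
    (ht0 : 0 ≤ t) (ht : t < p) (hκ : 1 ≤ κ) :
    Tendsto (fun w => hypDiff p s t κ w / w) (𝓝[>] 0) (𝓝 ((t - κ * s) / p)) := by
  have h1 := (hasDerivAt_hypDiff hp h0 hs ht0 ht hκ ⟨le_rfl, one_pos⟩).tendsto_slope_zero_right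
  refine (h1.congr fun w => ?_).trans (le_of_eq ?_)
  · rw [zero_add, hypDiff_zero, sub_zero, smul_eq_mul, div_eq_inv_mul]
  · congr 1
    simp only [hypDiffDeriv, sub_zero, Real.one_rpow, sub_self, zbSeries_zero]
    ring

theorem tendsto_one_sub_one_sub_rpow {κ : ℝ} (hκ : 0 < κ) :
    Tendsto (fun w : ℝ => 1 - (1 - w) ^ κ) (𝓝[<] 1) (𝓝[<] 1) := by
  refine tendsto_nhdsWithin_of_tendsto_nhds_of_eventually_within _ ?_ ?_
  · have h1 : ContinuousAt (fun w : ℝ => 1 - (1 - w) ^ κ) 1 :=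
      continuousAt_const.sub ((continuousAt_const.sub continuousAt_id).rpow_const (Or.inr hκ.le))
    have h2 := h1.tendsto
    simp only [sub_self, Real.zero_rpow hκ.ne', sub_zero] at h2
    exact h2.mono_left nhdsWithin_le_nhds
  · filter_upwards [self_mem_nhdsWithin] with w hw
    exact one_sub_one_sub_rpow_lt_one hw

theorem tendsto_hypDiff_div_one {A B A' B' p κ : ℝ} (hp : 1 ≤ p) (hAB : A + B = p - 1)
    (hA : 0 < A + 1) (hB : 0 < B + 1) (hAB' : A' + B' = p - 1) (hA' : 0 < A' + 1)
    (hB' : 0 < B' + 1) (hκ : 0 < κ) :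
    Tendsto (fun w => hypDiff p (-(A * B)) (-(A' * B')) κ w / w) (𝓝[<] 1)
      (𝓝 (gaussValue p A B - gaussValue p A' B')) := by
  have h1 := ((tendsto_hypSeries_one hp hAB hA hB).comp (tendsto_one_sub_one_sub_rpow hκ)).sub
    (tendsto_hypSeries_one hp hAB' hA' hB')
  have h2 : Tendsto (fun w : ℝ => w) (𝓝[<] 1) (𝓝 1) := nhdsWithin_le_nhds
  have h3 := h1.div h2 one_ne_zero
  rw [div_one] at h3
  exact h3

/-- The image of a continuous strictly increasing function with given one-sided limits. -/
theorem image_Ioo_of_strictMonoOn_of_tendsto {g : ℝ → ℝ} {l u : ℝ} (hg : StrictMonoOn g (Ioo 0 1))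
    (hc : ContinuousOn g (Ioo 0 1)) (hl : Tendsto g (𝓝[>] 0) (𝓝 l))
    (hu : Tendsto g (𝓝[<] 1) (𝓝 u)) : g '' Ioo 0 1 = Ioo l u := by
  have e0 : ∀ y : ℝ, 0 < y → Ioo 0 y ∈ 𝓝[>] (0 : ℝ) := fun y hy => Ioo_mem_nhdsGT hy
  have e1 : ∀ y : ℝ, y < 1 → Ioo y 1 ∈ 𝓝[<] (1 : ℝ) := fun y hy => Ioo_mem_nhdsLT hy
  refine Subset.antisymm ?_ ?_
  · rintro _ ⟨x, hx, rfl⟩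
    obtain ⟨y, hy0, hyx⟩ := exists_between hx.1
    obtain ⟨z, hxz, hz1⟩ := exists_between hx.2
    have hy : y ∈ Ioo (0 : ℝ) 1 := ⟨hy0, hyx.trans hx.2⟩
    have hz : z ∈ Ioo (0 : ℝ) 1 := ⟨hx.1.trans hxz, hz1⟩
    refine ⟨(le_of_tendsto hl ?_).trans_lt (hg hy hx hyx),
      (hg hx hz hxz).trans_le (ge_of_tendsto hu ?_)⟩
    · filter_upwards [e0 y hy0] with v hv
      exact (hg ⟨hv.1, hv.2.trans hy.2⟩ hy hv.2).le
    · filter_upwards [e1 z hz1] with v hv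
      exact (hg hz ⟨hz.1.trans hv.1, hv.2⟩ hv.1).le
  · exact isPreconnected_Ioo.intermediate_value_Ioo
      (le_principal_iff.2 (e0 1 one_pos)) (le_principal_iff.2 (e1 0 one_pos)) hc hl hu

/-! ### Passage between the variables x and w -/

theorem one_sub_rpow_mem {c x : ℝ} (hc : 0 < c) (hx : x ∈ Ioo (0 : ℝ) 1) :
    1 - x ^ c ∈ Ioo (0 : ℝ) 1 :=
  ⟨sub_pos.2 (Real.rpow_lt_one hx.1.le hx.2 hc), sub_lt_self _ (Real.rpow_pos_of_pos hx.1 c)⟩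

theorem exists_one_sub_rpow_eq {c w : ℝ} (hc : 0 < c) (hw : w ∈ Ioo (0 : ℝ) 1) :
    ∃ x ∈ Ioo (0 : ℝ) 1, 1 - x ^ c = w := by
  have h1 : 0 < 1 - w := sub_pos.2 hw.2
  refine ⟨(1 - w) ^ c⁻¹, ⟨Real.rpow_pos_of_pos h1 _,
    Real.rpow_lt_one h1.le (by linarith [hw.1]) (inv_pos.2 hc)⟩, ?_⟩
  rw [← Real.rpow_mul h1.le, inv_mul_cancel₀ hc.ne', Real.rpow_one]
  ring

theorem F_sub_F_eq_hypDiff {A B A' B' p c d x : ℝ} (hp : 1 ≤ p) (hAB : A + B = p - 1)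
    (hAB' : A' + B' = p - 1) (hc : 0 < c) (hx : 0 ≤ x) :
    F A B p (1 - x ^ d) - F A' B' p (1 - x ^ c) =
      hypDiff p (-(A * B)) (-(A' * B')) (d / c) (1 - x ^ c) := by
  rw [hypDiff, F_eq_hypSeries hp hAB, F_eq_hypSeries hp hAB', sub_sub_cancel, ← Real.rpow_mul hx,
    mul_div_cancel₀ _ hc.ne']

theorem one_div_mul_B_eq_gaussValue {A B p : ℝ} (hp : 1 ≤ p) (hAB : A + B = p - 1)
    (hA : 0 < A + 1) (hB : 0 < B + 1) :
    1 / (p * ZeroBalanced.B (A + 1) (B + 1)) = gaussValue p A B := by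
  have h1 : A + 1 + (B + 1) = p + 1 := by linarith
  have h2 : 0 < p := by linarith
  have h3 := Real.Gamma_pos_of_pos hA
  have h4 := Real.Gamma_pos_of_pos hB
  have h5 := Real.Gamma_pos_of_pos h2
  rw [ZeroBalanced.B, ProbabilityTheory.beta, gaussValue, h1, Real.Gamma_add_one h2.ne']
  field_simp

/-! ### Inequalities among the parameters -/

/-- The quantity `(1 - a + δ)(b + δ)`, which plays for `δ` the role that `β` plays for `δ = 0`. -/
def σ (a b δ : ℝ) : ℝ := -((a - 1 - δ) * (b + δ))

theorem q_eq (a b c d δ : ℝ) : q a b c d δ = c / d * β a b - σ a b δ := by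
  rw [q, σ, β]; ring

theorem β_eq (a b : ℝ) : -((a - 1) * b) = β a b := by rw [β]; ring

section Parameters

variable {a b c d δ : ℝ}

theorem β_pos (ha : a ∈ Ioo (0 : ℝ) 1) (hb : 1 - a ≤ b) : 0 < β a b :=
  mul_pos (by linarith [ha.2]) (by linarith [ha.2])

theorem α_pos (ha : a ∈ Ioo (0 : ℝ) 1) (hb : 1 - a ≤ b) : 0 < α a b :=
  mul_pos ha.1 (by linarith [ha.2])

theorem α_add_β (a b : ℝ) : α a b + β a b = p a b := by rw [α, β, p]; ring

theorem one_le_p (hb : 1 - a ≤ b) : 1 ≤ p a b := by rw [p]; linarith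

theorem β_lt_p (ha : a ∈ Ioo (0 : ℝ) 1) (hb : 1 - a ≤ b) : β a b < p a b := by
  linarith [α_add_β a b, α_pos ha hb]

theorem k_pos (ha : a ∈ Ioo (0 : ℝ) 1) (hb : 1 - a ≤ b) : 0 < k a b := by
  have := β_pos ha hb
  have := one_le_p hb
  rw [k]
  positivity

theorem ratio_mul_k_le (ha : a ∈ Ioo (0 : ℝ) 1) (hb : 1 - a ≤ b)
    (hcd : c / d ≤ (β a b + p a b) / k a b) : c / d * k a b ≤ β a b + p a b :=
  (le_div_iff₀ (k_pos ha hb)).1 hcd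

theorem ratio_lt_one (ha : a ∈ Ioo (0 : ℝ) 1) (hb : 1 - a ≤ b)
    (hcd : c / d ≤ (β a b + p a b) / k a b) : c / d < 1 := by
  refine hcd.trans_lt ?_
  have h1 := β_pos ha hb
  have h2 := one_le_p hb
  rw [div_lt_one (k_pos ha hb), k]
  nlinarith

/-- This is 2 + t ≤ 2κ with t = β, as the key inequality requires; after clearing `k`, it reduces to
β² ≤ βp. -/
theorem ratio_mul_two_add_β_le (ha : a ∈ Ioo (0 : ℝ) 1) (hb : 1 - a ≤ b)
    (hcd : c / d ≤ (β a b + p a b) / k a b) : c / d * (2 + β a b) ≤ 2 := by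
  have h1 := β_pos ha hb
  have h2 := one_le_p hb
  have h3 := β_lt_p ha hb
  calc c / d * (2 + β a b) ≤ (β a b + p a b) / k a b * (2 + β a b) :=
        mul_le_mul_of_nonneg_right hcd (by linarith)
    _ ≤ 2 := by
        rw [div_mul_eq_mul_div, div_le_iff₀ (k_pos ha hb), k]
        nlinarith

theorem discrim_pos (ha : a ∈ Ioo (0 : ℝ) 1) (hb : 1 - a ≤ b) (hc : 0 < c) (hd : 0 < d) :
    (p a b - 1) ^ 2 < (p a b - 1) ^ 2 + 4 * β a b * (c / d) := by
  have := β_pos ha hb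
  have : 0 < 4 * β a b * (c / d) := by positivity
  linarith

theorem isGreatest_δ₁ (ha : a ∈ Ioo (0 : ℝ) 1) (hb : 1 - a ≤ b) (hc : 0 < c) (hd : 0 < d) :
    IsGreatest {δ : ℝ | q a b c d δ = 0} (δ₁ a b c d) := by
  have h1 := (sq_nonneg _).trans (discrim_pos ha hb hc hd).le
  constructor
  · have h2 := Real.sq_sqrt h1
    -- This identifies the radicand in `δ₁` with the discriminant of `q`.
    have h3 : (p a b - 1) ^ 2 = (a - b - 1) ^ 2 - 4 * β a b := by rw [p, β]; ring
    simp only [mem_ofPred_eq, q, δ₁]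
    linear_combination (-1 / 4) * h2 - h3 / 4
  · intro δ hδ
    have hδ' : q a b c d δ = 0 := hδ
    have h2 : 2 * δ - (a - b - 1) ≤ √((p a b - 1) ^ 2 + 4 * β a b * (c / d)) := by
      refine Real.le_sqrt_of_sq_le (le_of_eq ?_)
      simp only [q, p, β] at hδ' ⊢
      linear_combination -4 * hδ'
    rw [δ₁]
    linarith

theorem sub_one_lt_δ₁ (ha : a ∈ Ioo (0 : ℝ) 1) (hb : 1 - a ≤ b) (hc : 0 < c) (hd : 0 < d) :
    a - 1 < δ₁ a b c d := by
  have h1 := Real.lt_sqrt_of_sq_lt (discrim_pos ha hb hc hd)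
  rw [p] at h1
  rw [δ₁, p]
  linarith

theorem δ₁_neg (ha : a ∈ Ioo (0 : ℝ) 1) (hb : 1 - a ≤ b)
    (hcd : c / d ≤ (β a b + p a b) / k a b) : δ₁ a b c d < 0 := by
  have h1 : √((p a b - 1) ^ 2 + 4 * β a b * (c / d)) < b + 1 - a := by
    rw [Real.sqrt_lt' (by linarith [ha.2])]
    have h2 := mul_lt_mul_of_pos_left (ratio_lt_one ha hb hcd) (β_pos ha hb)
    have h3 : (p a b - 1) ^ 2 + 4 * β a b = (b + 1 - a) ^ 2 := by rw [p, β]; ring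
    linarith
  rw [δ₁]
  linarith

theorem σ_δ₁ (ha : a ∈ Ioo (0 : ℝ) 1) (hb : 1 - a ≤ b) (hc : 0 < c) (hd : 0 < d) :
    σ a b (δ₁ a b c d) = c / d * β a b := by
  have h1 : q a b c d (δ₁ a b c d) = 0 := (isGreatest_δ₁ ha hb hc hd).1
  rw [q_eq] at h1
  linarith

theorem σ_strictMonoOn (hb : 1 - a ≤ b) : StrictMonoOn (σ a b) (Ioi (a - 1)) := by
  intro x hx y hy hxy
  simp only [Set.mem_Ioi] at hx hy
  simp only [σ]
  nlinarith

theorem σ_pos (hb : 1 - a ≤ b) (hδ : a - 1 < δ) : 0 < σ a b δ := by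
  have : 0 < (1 - a + δ) * (b + δ) := mul_pos (by linarith) (by linarith)
  rw [σ]
  linarith

/-- The value at `x = 1` of the second-derivative expression is nonnegative. -/
theorem convexity_condition (ha : a ∈ Ioo (0 : ℝ) 1) (hb : 1 - a ≤ b)
    (hαβ : √3 * β a b ≤ α a b ∨ (α a b < √3 * β a b ∧
      p a b ^ 4 ≤ 4 * h a b * (β a b + p a b)))
    (hc : 0 < c) (hd : 0 < d) (hcd : c / d ≤ (β a b + p a b) / k a b) {s : ℝ} (h0 : 0 < s)
    (hs : s ≤ c / d * β a b) :
    0 ≤ β a b * (p a b - β a b) + s * (d / c * (d / c - 1) * (p a b + 1) -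
      (d / c) ^ 2 * (p a b - s)) := by
  have hr0 : 0 < c / d := by positivity
  have hr1 := ratio_lt_one ha hb hcd
  have hrk := ratio_mul_k_le ha hb hcd
  have hα := α_pos ha hb
  have hβ := β_pos ha hb
  have hp := α_add_β a b
  have hinv : d / c = (c / d)⁻¹ := (inv_div c d).symm
  -- Multiply by (c/d)² to get a quadratic in s, with r = c/d: s² - (r(p + 1) - 1)s + r²αβ.
  suffices hE : 0 ≤ (c / d) ^ 2 * (β a b * α a b) +
      s * ((1 - c / d) * (p a b + 1) - (p a b - s)) by
    have h1 : β a b * (p a b - β a b) + s * (d / c * (d / c - 1) * (p a b + 1) -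
        (d / c) ^ 2 * (p a b - s)) = ((c / d) ^ 2 * (β a b * α a b) +
          s * ((1 - c / d) * (p a b + 1) - (p a b - s))) / (c / d) ^ 2 := by
      rw [hinv, ← hp]
      generalize c / d = r at *
      field_simp
      ring
    rw [h1]
    positivity
  generalize c / d = r at *
  rcases hαβ with h1 | ⟨-, h1⟩
  · have h2 : (1 : ℝ) ≤ √3 := by rw [Real.one_le_sqrt]; norm_num
    have h3 : β a b ≤ α a b := (le_mul_of_one_le_left hβ.le h2).trans h1
    have h4 : s ≤ r * α a b := hs.trans (mul_le_mul_of_nonneg_left h3 hr0.le)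
    have h5 := mul_nonneg (sub_nonneg.2 hs) (sub_nonneg.2 h4)
    have h6 := mul_nonneg h0.le (sub_nonneg.2 hr1.le)
    rw [← hp]
    linarith
  · rw [k] at hrk
    rw [h] at h1
    generalize α a b = A at *
    generalize β a b = T at *
    generalize p a b = P at *
    have hP : 0 < P + T := by linarith
    -- With D = P²/(P + T), the bound on r gives r(P + 1) - 1 ≤ rD, and the quartic hypothesis says
    -- D² ≤ 4AT. So s² - rDs + r²AT has nonpositive discriminant and bounds the quadratic from
    -- below.
    have h2 : r * (P + 1) - 1 ≤ r * (P ^ 2 / (P + T)) := by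
      rw [← mul_div_assoc, le_div_iff₀ hP]
      nlinarith
    have h3 : (P ^ 2 / (P + T)) ^ 2 ≤ 4 * (A * T) := by
      rw [div_pow, div_le_iff₀ (by positivity)]
      linarith
    generalize P ^ 2 / (P + T) = D at *
    have h4 := mul_le_mul_of_nonneg_left h2 h0.le
    have h5 := mul_le_mul_of_nonneg_left h3 (sq_nonneg r)
    nlinarith [sq_nonneg (2 * s - r * D)]

end Parameters

end ZeroBalanced

end

/-! ### The main theorem -/

theorem theorem1p1 (a b c d : ℝ) (ha : a ∈ Ioo (0 : ℝ) 1) (hb : 1 - a ≤ b)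
    (hαβ : √3 * ZeroBalanced.β a b ≤ ZeroBalanced.α a b ∨
      (ZeroBalanced.α a b < √3 * ZeroBalanced.β a b ∧
        ZeroBalanced.p a b ^ 4 ≤
          4 * ZeroBalanced.h a b * (ZeroBalanced.β a b + ZeroBalanced.p a b)))
    (hc : 0 < c) (hd : 0 < d)
    (hcd : c / d ≤ (ZeroBalanced.β a b + ZeroBalanced.p a b) / ZeroBalanced.k a b) :
    -- `δ₁` is the larger root of the quadratic, and it is negative
    IsGreatest {δ : ℝ | ZeroBalanced.q a b c d δ = 0} (ZeroBalanced.δ₁ a b c d) ∧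
    ZeroBalanced.δ₁ a b c d < 0 ∧
    -- part (1)
    (∀ δ ∈ Ioc (a - 1) (ZeroBalanced.δ₁ a b c d),
      StrictAntiOn (ZeroBalanced.G a b c d δ) (Ioo 0 1) ∧
      ZeroBalanced.G a b c d δ '' Ioo 0 1 =
        Ioo (ZeroBalanced.C₁ a b c d δ) (ZeroBalanced.C₂ a b δ) ∧
      0 ≤ ZeroBalanced.C₁ a b c d δ ∧
      ∀ x ∈ Ioo (0 : ℝ) 1,
        ZeroBalanced.F (a - 1) b (ZeroBalanced.p a b) (1 - x ^ c) +
            ZeroBalanced.C₁ a b c d δ * (1 - x ^ c) <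
          ZeroBalanced.F (a - 1 - δ) (b + δ) (ZeroBalanced.p a b) (1 - x ^ d) ∧
        ZeroBalanced.F (a - 1 - δ) (b + δ) (ZeroBalanced.p a b) (1 - x ^ d) <
          ZeroBalanced.F (a - 1) b (ZeroBalanced.p a b) (1 - x ^ c) +
            ZeroBalanced.C₂ a b δ * (1 - x ^ c)) ∧
    -- part (2)
    (∀ δ ∈ Ioo (ZeroBalanced.δ₁ a b c d) 0,
      (¬ ∀ x ∈ Ioo (0 : ℝ) 1,
        ZeroBalanced.F (a - 1) b (ZeroBalanced.p a b) (1 - x ^ c) <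
          ZeroBalanced.F (a - 1 - δ) (b + δ) (ZeroBalanced.p a b) (1 - x ^ d)) ∧
      (¬ ∀ x ∈ Ioo (0 : ℝ) 1,
        ZeroBalanced.F (a - 1 - δ) (b + δ) (ZeroBalanced.p a b) (1 - x ^ d) <
          ZeroBalanced.F (a - 1) b (ZeroBalanced.p a b) (1 - x ^ c))) := by
  open ZeroBalanced Filter Topology in
  have hp := one_le_p hb
  have hβ0 := β_pos ha hb
  have hβp := β_lt_p ha hb
  have hr0 : 0 < c / d := by positivity
  have hr1 := ratio_lt_one ha hb hcd
  have hκ : 1 < d / c := by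
    rw [one_lt_div hc]
    rwa [div_lt_one hd] at hr1
  have hAB' : a - 1 + b = p a b - 1 := by rw [p]; ring
  have hAB : ∀ δ, a - 1 - δ + (b + δ) = p a b - 1 := fun δ => by rw [p]; ring
  have hA' : 0 < a - 1 + 1 := by linarith [ha.1]
  have hB' : 0 < b + 1 := by linarith [ha.2]
  have hA : ∀ δ < 0, 0 < a - 1 - δ + 1 := fun δ h => by linarith [ha.1]
  have hB : ∀ δ, a - 1 < δ → 0 < b + δ + 1 := fun δ h => by linarith [ha.2]
  have hδ₁ := δ₁_neg ha hb hcd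
  have hδ₁' := sub_one_lt_δ₁ ha hb hc hd
  have hσ₁ := σ_δ₁ ha hb hc hd
  have hdiff : ∀ δ, ∀ x ∈ Ioo (0 : ℝ) 1,
      F (a - 1 - δ) (b + δ) (p a b) (1 - x ^ d) - F (a - 1) b (p a b) (1 - x ^ c) =
        hypDiff (p a b) (σ a b δ) (β a b) (d / c) (1 - x ^ c) := fun δ x hx => by
    rw [F_sub_F_eq_hypDiff hp (hAB δ) hAB' hc hx.1.le, β_eq, σ]
  have hC₁ : ∀ δ, C₁ a b c d δ = (β a b - d / c * σ a b δ) / p a b := fun δ => by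
    have : 0 < p a b := by linarith
    rw [C₁, q_eq]
    field_simp
  have hC₂ : ∀ δ, a - 1 < δ → δ < 0 → C₂ a b δ =
      gaussValue (p a b) (a - 1 - δ) (b + δ) - gaussValue (p a b) (a - 1) b := fun δ h1 h2 => by
    rw [← one_div_mul_B_eq_gaussValue hp (hAB δ) (hA δ h2) (hB δ h1),
      ← one_div_mul_B_eq_gaussValue hp hAB' hA' hB', C₂]
    ring_nf
  have hlim₂ : ∀ δ, a - 1 < δ → δ < 0 →
      Tendsto (fun w => hypDiff (p a b) (σ a b δ) (β a b) (d / c) w / w) (𝓝[<] 1)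
        (𝓝 (C₂ a b δ)) := fun δ h1 h2 => by
    rw [hC₂ δ h1 h2, σ, ← β_eq]
    exact tendsto_hypDiff_div_one hp (hAB δ) (hA δ h2) (hB δ h1) hAB' hA' hB' (by linarith)
  have hσβ : ∀ δ, a - 1 < δ → δ < 0 → σ a b δ < β a b := fun δ h1 h2 => by
    have h3 := σ_strictMonoOn hb h1 (by simpa using ha.2 : (0 : ℝ) ∈ Ioi (a - 1)) h2
    have h4 : σ a b 0 = β a b := by rw [σ, β]; ring
    linarith
  have hlim₁ : ∀ δ, a - 1 < δ → δ < 0 →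
      Tendsto (fun w => hypDiff (p a b) (σ a b δ) (β a b) (d / c) w / w) (𝓝[>] 0)
        (𝓝 (C₁ a b c d δ)) := fun δ h1 h2 => by
    rw [hC₁]
    exact tendsto_hypDiff_div_zero hp (σ_pos hb h1).le ((hσβ δ h1 h2).trans hβp) hβ0.le hβp hκ.le
  refine ⟨isGreatest_δ₁ ha hb hc hd, hδ₁, fun δ hδ => ?_, fun δ hδ => ?_⟩
  · have hδ0 : δ < 0 := hδ.2.trans_lt hδ₁
    have hs0 := σ_pos hb hδ.1
    have hsr : σ a b δ ≤ c / d * β a b :=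
      hσ₁ ▸ (σ_strictMonoOn hb).monotoneOn hδ.1 hδ₁' hδ.2
    have hsβ := hσβ δ hδ.1 hδ0
    have hκβ : 2 + β a b ≤ 2 * (d / c) := by
      have h1 := ratio_mul_two_add_β_le ha hb hcd
      rw [div_mul_eq_mul_div, div_le_iff₀ hd] at h1
      rw [← mul_div_assoc, le_div_iff₀ hc]
      linarith
    have hmono := strictMonoOn_hypDiff_div hp hs0 hsβ.le hβp hκ hκβ
      (convexity_condition ha hb hαβ hc hd hcd hs0 hsr)
    have himg := image_Ioo_of_strictMonoOn_of_tendsto hmono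
      (continuousOn_hypDiff_div hp hs0.le (hsβ.trans hβp) hβ0.le hβp hκ.le)
      (hlim₁ δ hδ.1 hδ0) (hlim₂ δ hδ.1 hδ0)
    have hG : ∀ x ∈ Ioo (0 : ℝ) 1, G a b c d δ x =
        hypDiff (p a b) (σ a b δ) (β a b) (d / c) (1 - x ^ c) / (1 - x ^ c) := fun x hx => by
      rw [G, hdiff δ x hx]
    have hGimg : G a b c d δ '' Ioo 0 1 = Ioo (C₁ a b c d δ) (C₂ a b δ) := by
      rw [← himg]
      ext y
      constructor
      · rintro ⟨x, hx, rfl⟩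
        exact ⟨1 - x ^ c, one_sub_rpow_mem hc hx, (hG x hx).symm⟩
      · rintro ⟨w, hw, rfl⟩
        obtain ⟨x, hx, rfl⟩ := exists_one_sub_rpow_eq hc hw
        exact ⟨x, hx, hG x hx⟩
    refine ⟨fun x hx y hy hxy => ?_, hGimg, ?_, fun x hx => ?_⟩
    · rw [hG x hx, hG y hy]
      exact hmono (one_sub_rpow_mem hc hy) (one_sub_rpow_mem hc hx)
        (sub_lt_sub_left (Real.rpow_lt_rpow hx.1.le hxy hc) 1)
    · rw [C₁, q_eq]
      have : 0 < p a b := by linarith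
      exact mul_nonneg (by positivity) (sub_nonneg.2 hsr)
    · have h1 : G a b c d δ x ∈ Ioo (C₁ a b c d δ) (C₂ a b δ) := hGimg ▸ mem_image_of_mem _ hx
      have hw := (one_sub_rpow_mem hc hx).1
      rw [G, Set.mem_Ioo, lt_div_iff₀ hw, div_lt_iff₀ hw] at h1
      constructor <;> linarith [h1.1, h1.2]
  · have hδ1 := hδ₁'.trans hδ.1
    have hsr : c / d * β a b < σ a b δ := hσ₁ ▸ σ_strictMonoOn hb hδ₁' hδ1 hδ.1
    have hC₁neg : C₁ a b c d δ < 0 := by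
      rw [C₁, q_eq]
      have : 0 < p a b := by linarith
      exact mul_neg_of_pos_of_neg (by positivity) (sub_neg.2 hsr)
    have hC₂pos : 0 < C₂ a b δ := by
      rw [hC₂ δ hδ1 hδ.2, sub_pos]
      refine gaussValue_lt hp hAB' hA' hB' (hAB δ) (hA δ hδ.2) (hB δ hδ1) ?_
      have := hσβ δ hδ1 hδ.2
      rw [σ, ← β_eq] at this
      linarith
    constructor <;> intro hall
    -- A negative limit C₁ at w = 0 gives a point refuting the first inequality; the positive limit
    -- C₂ at w = 1 refutes the reverse.
    · obtain ⟨w, hw, hw'⟩ := (((hlim₁ δ hδ1 hδ.2).eventually_lt_const hC₁neg).and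
        (Ioo_mem_nhdsGT one_pos)).exists
      obtain ⟨x, hx, rfl⟩ := exists_one_sub_rpow_eq hc hw'
      rw [div_lt_iff₀ hw'.1, zero_mul, ← hdiff δ x hx] at hw
      linarith [hall x hx]
    · obtain ⟨w, hw, hw'⟩ := (((hlim₂ δ hδ1 hδ.2).eventually_const_lt hC₂pos).and
        (Ioo_mem_nhdsLT one_pos)).exists
      obtain ⟨x, hx, rfl⟩ := exists_one_sub_rpow_eq hc hw'
      rw [lt_div_iff₀ hw'.1, zero_mul, ← hdiff δ x hx] at hw
      linarith [hall x hx]
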